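/- Let $\pi:\mathbb{R}\to(0,\infty)$ be such that $\log\pi$ is uniformly continuous (the target density, which need not be normalised), let $\tilde q$ be a symmetric probability density on $\mathbb{R}$, let $\theta>0$, and let $x_1,m_1\in\mathbb{R}$ and $s_1>0$. Let $(\eta_n)_{n\ge 2}\subset(0,1)$ satisfy $$\lim_{n\to\infty}\frac{\eta_{n+1}}{\eta_n}=1,\qquad \sum_{n=2}^\infty\eta_n=\infty,\qquad \sum_{n=2}^\infty\eta_n^2<\infty .$$ For $s>0$ put $\tilde q_s(z)=(\theta s)^{-1/2}\,\tilde q\big((\theta s)^{-1/2}z\big)$, and for a symmetric probability density $q$ let $P_q$ be the Metropolis transition kernel $$P_q(x,A)=\mathbf 1_A(x)\Big[1-\int_{\mathbb{R}}\min\Big\{1,\frac{\pi(y)}{\pi(x)}\Big\}q(y-x)\,dy\Big]+\int_A\min\Big\{1,\frac{\pi(y)}{\pi(x)}\Big\}q(y-x)\,dy .$$ The one-dimensional unconstrained adaptive Metropolis process $(X_n,M_n,S_n)_{n\ge1}$ starts at $(X_1,M_1,S_1)=(x_1,m_1,s_1)$ and satisfies, for $n\ge1$ and with $\mathcal F_n=\sigma(X_k,M_k,S_k:1\le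 k\le n)$, $$\mathbb{P}(X_{n+1}\in A\mid\mathcal F_n)=P_{\tilde q_{S_n}}(X_n,A)\quad\text{a.s. for every Borel set }A\subset\mathbb{R},$$ $$M_{n+1}=(1-\eta_{n+1})M_n+\eta_{n+1}X_{n+1},\qquad S_{n+1}=(1-\eta_{n+1})S_n+\eta_{n+1}(X_{n+1}-M_n)^2 .$$ Then there is a deterministic constant $b>0$ such that every such process (on any probability space) satisfies $\liminf_{n\to\infty}S_n\ge b$ almost surely, where the value $+\infty$ of the limit inferior is allowed. -/

import Mathlib

open MeasureTheory Filter Topology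

noncomputable section

namespace AdaptiveMetropolis

/-- `q` is a symmetric probability density on the real line. -/
structure IsSymmetricDensity (q : ℝ → ℝ) : Prop where
  measurable : Measurable q
  nonneg : ∀ z, 0 ≤ q z
  integral_eq_one : ∫ z, q z = 1
  symmetric : ∀ z, q (-z) = q z

/-- The acceptance probability of a move from `x` to `y` for the target `π`. -/
def acceptProb (π : ℝ → ℝ) (x y : ℝ) : ℝ := min 1 (π y / π x)

/-- The one-step transition law `P_q(x, ·)` of the random-walk Metropolis algorithm with target `π`
and increment density `q`:
`P_q(x, A) = 1_A(x) [1 - ∫ min(1, π(y)/π(x)) q(y-x) dy] + ∫_A min(1, π(y)/π(x)) q(y-x) dy`. -/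
def metropolisLaw (π q : ℝ → ℝ) (x : ℝ) : Measure ℝ :=
  ENNReal.ofReal (1 - ∫ y, acceptProb π x y * q (y - x)) • Measure.dirac x
    + volume.withDensity (fun y => ENNReal.ofReal (acceptProb π x y * q (y - x)))

/-- The adaptive proposal density `z ↦ (θ s)^(-1/2) q((θ s)^(-1/2) z)`. -/
def scaledProposal (q : ℝ → ℝ) (θ s : ℝ) (z : ℝ) : ℝ :=
  (Real.sqrt (θ * s))⁻¹ * q ((Real.sqrt (θ * s))⁻¹ * z)

/-- The history `σ(X k, M k, S k : 1 ≤ k ≤ n)`. -/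
abbrev history {Ω : Type*} (X M S : ℕ → Ω → ℝ) (n : ℕ) : MeasurableSpace Ω :=
  ⨆ k ∈ Set.Icc 1 n,
    MeasurableSpace.comap (fun ω => (X k ω, M k ω, S k ω)) inferInstance

/-- `(X n, M n, S n)`, `n ≥ 1`, is a one-dimensional unconstrained adaptive Metropolis process
with target `π`, template proposal density `q`, scaling constant `θ`, weights `(η n)`, `n ≥ 2`,
and initial values `x₁`, `m₁`, `s₁`. The values at index `0` (and `η 0`, `η 1`) play no role. -/
structure IsAMProcess {Ω : Type*} [MeasurableSpace Ω] (P : Measure Ω)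
    (π q : ℝ → ℝ) (θ : ℝ) (η : ℕ → ℝ) (x₁ m₁ s₁ : ℝ) (X M S : ℕ → Ω → ℝ) : Prop where
  measurable_X : ∀ n, 1 ≤ n → Measurable (X n)
  X_one : ∀ ω, X 1 ω = x₁
  M_one : ∀ ω, M 1 ω = m₁
  S_one : ∀ ω, S 1 ω = s₁
  /-- Given the history up to time `n`, `X (n+1)` has the Metropolis law started from `X n` with
  the proposal density scaled by `S n`. -/
  X_succ : ∀ n, 1 ≤ n → ∀ A : Set ℝ, MeasurableSet A →
    P[(X (n + 1) ⁻¹' A).indicator (fun _ => (1 : ℝ)) | history X M S n]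
      =ᵐ[P] fun ω => (metropolisLaw π (scaledProposal q θ (S n ω)) (X n ω)).real A
  M_succ : ∀ n, 1 ≤ n → ∀ ω,
    M (n + 1) ω = (1 - η (n + 1)) * M n ω + η (n + 1) * X (n + 1) ω
  S_succ : ∀ n, 1 ≤ n → ∀ ω,
    S (n + 1) ω = (1 - η (n + 1)) * S n ω + η (n + 1) * (X (n + 1) ω - M n ω) ^ 2

end AdaptiveMetropolis

end

noncomputable section

namespace AdaptiveMetropolis

/-! Write Z_n = (X_n - M_n)/√S_n, Y = (X_{n+1} - M_n)/√S_n and e = η_{n+1}. Then log S_{n+1} - log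
S_n = log(1 - e + eY²), roughly e(Y² - 1), and Z_{n+1} is close to Y unless Y is large. So the scale
can keep shrinking only while the innovations stay small. Small innovations cannot persist:
proposals have size √(θS_n), and when S_n is small nearly all are accepted, uniformly in the
position, because log π is uniformly continuous.

The quantitative form uses that, up to rejections, one step multiplies the conditional mean of the
cosine by φ = `cosTransform q (√θ/2)`: E[cos(Y/2) | F_n] ≤ φ cos(Z_n/2) + ε, with φ < 1. With A(1 -
φ) = 3 and p(z) = A cos(z/2) + min(z², 9), the inequality 3cos(z/2) + min(z², 9) ≥ 3 makes log S_n
increase by at least e(p(Z_{n+1}) - p(Z_n)) + e/4, up to a martingale increment and O(e²), whenever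
S_n < b (`log_scale_step`, `exists_integral_cos_metropolisLaw_le`).

The martingale converges since Ση² < ∞, and the bounded potential contributes little since η varies
slowly. As Ση = ∞, the drift brings S_n up to b, and from then on S_n cannot fall far below b
(`eventually_half_le_of_drift`). -/

/-! ### Pathwise growth of the logarithmic scale -/

/-- The bounded potential compensating the logarithmic scale. -/
def potential (A z : ℝ) : ℝ := A * Real.cos (z / 2) + min (z ^ 2) 9

theorem abs_potential_le {A : ℝ} (hA : 0 ≤ A) (z : ℝ) : |potential A z| ≤ A + 9 := by
  have h1 := Real.neg_one_le_cos (z / 2)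
  have h2 := Real.cos_le_one (z / 2)
  have h3 : 0 ≤ min (z ^ 2) (9 : ℝ) := le_min (sq_nonneg z) (by norm_num)
  have h4 : min (z ^ 2) (9 : ℝ) ≤ 9 := min_le_right _ _
  rw [potential, abs_le]
  constructor <;> nlinarith

/-- Source of the strict drift: the cosine term pays when z is near 0, the truncated square
elsewhere. The frequency 1/2 keeps the loss 3z²/8 of the cosine below z². -/
theorem three_le_three_mul_cos_add_min (z : ℝ) :
    3 ≤ 3 * Real.cos (z / 2) + min (z ^ 2) 9 := by
  have h1 := Real.one_sub_sq_div_two_le_cos (x := z / 2)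
  have h2 := Real.neg_one_le_cos (z / 2)
  rcases le_total (z ^ 2) 9 with h | h
  · rw [min_eq_left h]; nlinarith [sq_nonneg z]
  · rw [min_eq_right h]; linarith

theorem sub_two_mul_sq_le_log_one_add {u : ℝ} (hu : -(1 / 2) ≤ u) :
    u - 2 * u ^ 2 ≤ Real.log (1 + u) := by
  have h1 : 0 < 1 + u := by linarith
  have h2 := Real.one_sub_inv_le_log_of_pos h1
  have h3 : 1 - (1 + u)⁻¹ = u / (1 + u) := by field_simp; ring
  rw [h3] at h2
  refine le_trans ?_ h2
  rw [le_div_iff₀ h1]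
  nlinarith [mul_nonneg (sq_nonneg u) (by linarith : 0 ≤ 1 + 2 * u)]

/-- Here Y is the innovation standardised before the update, and the argument of `potential` is the
same innovation standardised after it. The two differ by O(e) for bounded Y, so the cosines nearly
cancel and leave min(Y², 9) - 1 ≤ Y² - 1, the first-order growth of the logarithm. -/
theorem log_scale_step {A R : ℝ} (hA : 0 ≤ A) (hR : 1 ≤ R) (hRA : 2 * A + 9 ≤ R ^ 2)
    {e : ℝ} (he : 0 < e) (he' : e ≤ 1 / 2) (Y : ℝ) :
    e * (potential A ((1 - e) * Y / Real.sqrt (1 - e + e * Y ^ 2)) - 1 - A * Real.cos (Y / 2))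
      - (2 * R ^ 4 + 2 * A * R ^ 3) * e ^ 2 ≤ Real.log (1 - e + e * Y ^ 2) := by
  set r := 1 - e + e * Y ^ 2 with hr
  have hr0 : 1 - e ≤ r := by nlinarith [sq_nonneg Y]
  have hrpos : 0 < r := by linarith
  set Z := (1 - e) * Y / Real.sqrt r with hZ
  have hR4 : 1 ≤ R ^ 4 := one_le_pow₀ hR
  have hR2 : 1 ≤ R ^ 2 := one_le_pow₀ hR
  rcases le_total |Y| R with hY | hY
  · have hY2 : Y ^ 2 ≤ R ^ 2 := sq_le_sq' (by linarith [(abs_le.mp hY).1]) (abs_le.mp hY).2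
    have hu : |Y ^ 2 - 1| ≤ R ^ 2 := by
      rw [abs_le]; constructor <;> nlinarith [sq_nonneg Y]
    have hlog : e * (Y ^ 2 - 1) - 2 * (e * (Y ^ 2 - 1)) ^ 2 ≤ Real.log r := by
      have := sub_two_mul_sq_le_log_one_add (u := e * (Y ^ 2 - 1)) (by nlinarith [sq_nonneg Y])
      rwa [show 1 + e * (Y ^ 2 - 1) = r by rw [hr]; ring] at this
    have hsq : (e * (Y ^ 2 - 1)) ^ 2 ≤ e ^ 2 * R ^ 4 := by
      have : (Y ^ 2 - 1) ^ 2 ≤ (R ^ 2) ^ 2 := sq_le_sq' (abs_le.mp hu).1 (abs_le.mp hu).2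
      rw [mul_pow]; nlinarith [sq_nonneg e]
    have hZ2 : Z ^ 2 ≤ Y ^ 2 := by
      rw [hZ, div_pow, Real.sq_sqrt hrpos.le, div_le_iff₀ hrpos, mul_pow]
      have : (1 - e) ^ 2 ≤ r := by nlinarith
      nlinarith [sq_nonneg Y]
    have hsr : 1 / 2 ≤ Real.sqrt r := by
      apply Real.le_sqrt_of_sq_le; nlinarith
    have hsr0 : 0 < Real.sqrt r := by linarith
    have hsr1 : |1 - Real.sqrt r| ≤ |1 - r| := by
      have : 1 - r = (1 - Real.sqrt r) * (1 + Real.sqrt r) := by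
        nlinarith [Real.mul_self_sqrt hrpos.le]
      rw [this, abs_mul]
      have : 1 ≤ |1 + Real.sqrt r| := by rw [abs_of_pos (by linarith)]; linarith
      nlinarith [abs_nonneg (1 - Real.sqrt r)]
    have h1r : |1 - r| ≤ e * R ^ 2 := by
      rw [show 1 - r = -(e * (Y ^ 2 - 1)) by rw [hr]; ring, abs_neg, abs_mul, abs_of_pos he]
      exact mul_le_mul_of_nonneg_left hu he.le
    have hZY : |Z - Y| ≤ 4 * e * R ^ 3 := by
      have h1 : Z - Y = Y * ((1 - Real.sqrt r) - e) / Real.sqrt r := by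
        rw [hZ]; field_simp; ring
      rw [h1, abs_div, abs_of_pos hsr0, div_le_iff₀ hsr0, abs_mul]
      have h2 : |1 - Real.sqrt r - e| ≤ 2 * (e * R ^ 2) := by
        have := abs_sub (1 - Real.sqrt r) e
        rw [abs_of_pos he] at this
        nlinarith
      have h3 : |Y| * |1 - Real.sqrt r - e| ≤ R * (2 * (e * R ^ 2)) :=
        mul_le_mul hY h2 (abs_nonneg _) (by linarith)
      have h4 : 0 ≤ e * R ^ 3 := by positivity
      nlinarith
    have hcos : Real.cos (Z / 2) - Real.cos (Y / 2) ≤ 2 * e * R ^ 3 := by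
      have h1 := Real.abs_cos_sub_cos_le (Z / 2) (Y / 2)
      have h2 : |Z / 2 - Y / 2| = |Z - Y| / 2 := by
        rw [← sub_div, abs_div, abs_two]
      rw [h2] at h1
      linarith [le_abs_self (Real.cos (Z / 2) - Real.cos (Y / 2))]
    have hmin : min (Z ^ 2) (9 : ℝ) ≤ Y ^ 2 := (min_le_left _ _).trans hZ2
    have h5 := mul_le_mul_of_nonneg_left hcos (mul_nonneg hA he.le)
    have h6 := mul_le_mul_of_nonneg_left hmin he.le
    rw [potential]
    nlinarith
  -- For a large innovation no comparison of cosines is needed: the bracket is at most 2A + 8 ≤ R² -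
  -- 1, and the logarithm already dominates its value at Y² = R².
  · have hY2 : R ^ 2 ≤ Y ^ 2 := by
      rw [← sq_abs Y]; exact pow_le_pow_left₀ (by linarith) hY 2
    have hlog : e * (R ^ 2 - 1) - 2 * (e * (R ^ 2 - 1)) ^ 2 ≤ Real.log r := by
      have h1 := sub_two_mul_sq_le_log_one_add (u := e * (R ^ 2 - 1)) (by nlinarith)
      refine h1.trans (Real.log_le_log (by nlinarith) ?_)
      rw [hr]; nlinarith
    have hsq : (e * (R ^ 2 - 1)) ^ 2 ≤ e ^ 2 * R ^ 4 := by
      have : (R ^ 2 - 1) ^ 2 ≤ (R ^ 2) ^ 2 := sq_le_sq' (by linarith) (by linarith)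
      rw [mul_pow]; nlinarith [sq_nonneg e]
    have h1 := (abs_le.mp (abs_potential_le hA Z)).2
    have h2 := mul_le_mul_of_nonneg_left (Real.neg_one_le_cos (Y / 2)) hA
    have h3 : potential A Z - 1 - A * Real.cos (Y / 2) ≤ R ^ 2 - 1 := by linarith
    have h4 := mul_le_mul_of_nonneg_left h3 he.le
    have h5 : 0 ≤ 2 * A * R ^ 3 * e ^ 2 := by positivity
    nlinarith

/-! ### Deterministic drift argument -/

/-- A positive sequence whose logarithm, up to a bounded potential and a convergent perturbation,
drifts upwards whenever the sequence is below `b` is eventually at least `b / 2`. -/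
theorem eventually_half_le_of_drift {S e p N : ℕ → ℝ} {b B C l : ℝ} (hb : 0 < b)
    (hS : ∀ n, 0 < S n) (hp : ∀ n, |p n| ≤ B) (he : ∀ n, e n ∈ Set.Ioo (0 : ℝ) 1)
    (hratio : Tendsto (fun n => e (n + 1) / e n) atTop (𝓝 1)) (hsum : ¬ Summable e)
    (he0 : Tendsto e atTop (𝓝 0)) (hN : Tendsto N atTop (𝓝 l))
    (hlow : ∀ n, (1 - e n) * S n ≤ S (n + 1))
    (hdrift : ∀ᶠ n in atTop, S n < b → e n * (p (n + 1) - p n) + e n / 4 - (N (n + 1) - N n)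
      - C * e n ^ 2 ≤ Real.log (S (n + 1)) - Real.log (S n)) :
    ∀ᶠ n in atTop, b / 2 ≤ S n := by
  have hB : 0 ≤ B := (abs_nonneg _).trans (hp 0)
  -- Absorbing potential and perturbation yields a quantity that increases below `b` and differs
  -- from log S by a convergent sequence.
  set H : ℕ → ℝ := fun n => Real.log (S n) - e n * p n + N n with hH
  have hstep : ∀ᶠ n in atTop, S n < b → H n + e n / 8 ≤ H (n + 1) := by
    -- Replacing `e n` by `e (n + 1)` in front of `p (n + 1)` costs at most e/16, and so does the
    -- quadratic term, leaving 1/4 - 1/8 = 1/8.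
    have h1 : ∀ᶠ n in atTop, |e (n + 1) / e n - 1| < 1 / (16 * (B + 1)) := by
      have := (Metric.tendsto_nhds.mp hratio) (1 / (16 * (B + 1))) (by positivity)
      simpa [Real.dist_eq] using this
    have h2 : ∀ᶠ n in atTop, e n < 1 / (16 * (|C| + 1)) :=
      he0.eventually_lt_const (by positivity)
    filter_upwards [hdrift, h1, h2] with n hd h1 h2 hn
    have hd := hd hn
    obtain ⟨hepos, -⟩ := he n
    have h3 : |e (n + 1) - e n| * (16 * (B + 1)) ≤ e n := by
      have : e (n + 1) - e n = (e (n + 1) / e n - 1) * e n := by field_simp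
      rw [this, abs_mul, abs_of_pos hepos]
      rw [lt_div_iff₀ (by positivity)] at h1
      nlinarith
    have h4 : (e (n + 1) - e n) * p (n + 1) ≤ |e (n + 1) - e n| * B := by
      calc _ ≤ |(e (n + 1) - e n) * p (n + 1)| := le_abs_self _
        _ = |e (n + 1) - e n| * |p (n + 1)| := abs_mul _ _
        _ ≤ _ := mul_le_mul_of_nonneg_left (hp _) (abs_nonneg _)
    have h5 : C * e n ^ 2 ≤ e n / 16 := by
      rw [lt_div_iff₀ (by positivity)] at h2
      have h6 := le_abs_self C
      have : C * e n ^ 2 ≤ |C| * e n ^ 2 := mul_le_mul_of_nonneg_right h6 (sq_nonneg _)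
      nlinarith
    have h7 := abs_nonneg (e (n + 1) - e n)
    simp only [hH]
    nlinarith
  have hHlim : Tendsto (fun n => H n - Real.log (S n)) atTop (𝓝 l) := by
    have h1 : Tendsto (fun n => e n * p n) atTop (𝓝 0) := by
      refine squeeze_zero_norm (a := fun n => e n * B) (fun n => ?_) (by simpa using he0.mul_const B)
      rw [norm_mul, Real.norm_eq_abs, Real.norm_eq_abs, abs_of_pos (he n).1]
      exact mul_le_mul_of_nonneg_left (hp n) (he n).1.le
    have h2 := hN.sub h1
    rw [sub_zero] at h2
    refine h2.congr fun n => ?_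
    simp only [hH]; ring
  -- Three errors of δ add up to the factor 2 lost: two in bounding H from below, one in returning
  -- to log S.
  set δ := Real.log 2 / 3 with hδ
  have hδ0 : 0 < δ := by have := Real.log_pos one_lt_two; positivity
  have hclose : ∀ᶠ n in atTop, |H n - Real.log (S n) - l| < δ := by
    simpa only [Real.dist_eq] using (Metric.tendsto_nhds.mp hHlim) δ hδ0
  have hloge : ∀ᶠ n in atTop, -δ < Real.log (1 - e n) := by
    have : Tendsto (fun n => Real.log (1 - e n)) atTop (𝓝 0) := by
      have h1 : Tendsto (fun n => 1 - e n) atTop (𝓝 1) := by simpa using he0.const_sub 1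
      simpa using h1.log one_ne_zero
    exact this.eventually_const_lt (by linarith)
  obtain ⟨n₁, hn₁⟩ := eventually_atTop.mp (hstep.and (hclose.and hloge))
  -- Staying below `b` forever would drive H to infinity, hence log S as well.
  obtain ⟨n₂, hn₂, hbn₂⟩ : ∃ n ≥ n₁, b ≤ S n := by
    by_contra! hcon
    have hlb : ∀ k, H n₁ + (∑ i ∈ Finset.range k, e (i + n₁)) / 8 ≤ H (k + n₁) := by
      intro k
      induction k with
      | zero => simp
      | succ k ih =>
        have h1 := (hn₁ (k + n₁) (by omega)).1 (hcon _ (by omega))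
        rw [Finset.sum_range_succ, show k + 1 + n₁ = k + n₁ + 1 by omega]
        linarith
    have hdiv : Tendsto (fun k => ∑ i ∈ Finset.range k, e (i + n₁)) atTop atTop := by
      rw [← not_summable_iff_tendsto_nat_atTop_of_nonneg (fun i => (he _).1.le)]
      rwa [summable_nat_add_iff n₁]
    obtain ⟨k, hk⟩ := (hdiv.eventually_gt_atTop (8 * (Real.log b + l + δ - H n₁))).exists
    have h1 := hlb k
    have h2 := (abs_lt.mp (hn₁ (k + n₁) (by omega)).2.1).2
    have h3 := Real.log_le_log (hS _) (hcon (k + n₁) (by omega)).le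
    linarith
  have hmain : ∀ n ≥ n₂, Real.log b + l - 2 * δ ≤ H n := by
    intro n hn
    induction n, hn using Nat.le_induction with
    | base =>
      have h2 := (abs_lt.mp (hn₁ n₂ hn₂).2.1).1
      have h3 := Real.log_le_log hb hbn₂
      linarith
    | succ n hn ih =>
      obtain ⟨h1, -, h3⟩ := hn₁ n (by omega)
      rcases lt_or_ge (S n) b with h | h
      · linarith [h1 h, (he n).1]
      -- From above `b` a single step loses at most the factor 1 - e, so a downcrossing starts from
      -- a controlled level.
      · have h4 := (abs_lt.mp (hn₁ (n + 1) (by omega)).2.1).1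
        have h5 := Real.log_le_log (mul_pos (by linarith [(he n).2]) (hS n)) (hlow n)
        rw [Real.log_mul (by linarith [(he n).2]) (hS n).ne'] at h5
        have h6 := Real.log_le_log hb h
        linarith
  filter_upwards [eventually_ge_atTop n₂] with n hn
  have h1 := hmain n hn
  have h2 := (abs_lt.mp (hn₁ n (by omega)).2.1).2
  have h3 : Real.log (b / 2) ≤ Real.log (S n) := by
    rw [Real.log_div hb.ne' two_ne_zero]
    linarith
  exact (Real.log_le_log_iff (by positivity) (hS n)).mp h3

/-! ### Cosine transforms and tails of symmetric densities -/

theorem IsSymmetricDensity.integrable {q : ℝ → ℝ} (hq : IsSymmetricDensity q) : Integrable q := by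
  by_contra h
  have := hq.integral_eq_one
  rw [integral_undef h] at this
  exact zero_ne_one this

theorem IsSymmetricDensity.integrable_mul {q f : ℝ → ℝ} (hq : IsSymmetricDensity q)
    (hf : Measurable f) {C : ℝ} (hC : ∀ z, |f z| ≤ C) : Integrable (fun z => f z * q z) :=
  hq.integrable.bdd_mul hf.aestronglyMeasurable (Eventually.of_forall hC)

/-- The characteristic function of a symmetric density. -/
def cosTransform (q : ℝ → ℝ) (t : ℝ) : ℝ := ∫ w, Real.cos (t * w) * q w

theorem IsSymmetricDensity.integral_sin_mul {q : ℝ → ℝ} (hq : IsSymmetricDensity q) (t : ℝ) :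
    ∫ w, Real.sin (t * w) * q w = 0 := by
  have h := integral_neg_eq_self (fun w => Real.sin (t * w) * q w) volume
  simp only [mul_neg, Real.sin_neg, hq.symmetric, neg_mul, integral_neg] at h
  linarith

theorem IsSymmetricDensity.integral_cos_add_mul {q : ℝ → ℝ} (hq : IsSymmetricDensity q)
    (a t : ℝ) : ∫ w, Real.cos (a + t * w) * q w = Real.cos a * cosTransform q t := by
  have h1 : Integrable (fun w => Real.cos a * (Real.cos (t * w) * q w)) :=
    (hq.integrable_mul (by fun_prop) fun z => Real.abs_cos_le_one _).const_mul _
  have h2 : Integrable (fun w => Real.sin a * (Real.sin (t * w) * q w)) :=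
    (hq.integrable_mul (by fun_prop) fun z => Real.abs_sin_le_one _).const_mul _
  calc ∫ w, Real.cos (a + t * w) * q w
      = ∫ w, (Real.cos a * (Real.cos (t * w) * q w) - Real.sin a * (Real.sin (t * w) * q w)) := by
        refine integral_congr_ae (Eventually.of_forall fun w => ?_)
        simp only [Real.cos_add]; ring
    _ = _ := by
        rw [integral_sub h1 h2, integral_const_mul, integral_const_mul, hq.integral_sin_mul,
          mul_zero, sub_zero, cosTransform]

theorem IsSymmetricDensity.cosTransform_lt_one {q : ℝ → ℝ} (hq : IsSymmetricDensity q)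
    {t : ℝ} (ht : t ≠ 0) : cosTransform q t < 1 := by
  have h1 : Integrable (fun w => Real.cos (t * w) * q w) :=
    hq.integrable_mul (by fun_prop) fun z => Real.abs_cos_le_one _
  have hle : ∀ w, Real.cos (t * w) * q w ≤ q w := fun w =>
    mul_le_of_le_one_left (hq.nonneg w) (Real.cos_le_one _)
  refine lt_of_le_of_ne (hq.integral_eq_one ▸ integral_mono h1 hq.integrable hle) fun heq => ?_
  rw [cosTransform, ← hq.integral_eq_one] at heq
  have hae := (integral_eq_iff_of_ae_le h1 hq.integrable (Eventually.of_forall hle)).mp heq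
  -- Equality would concentrate the law on a lattice, which is Lebesgue-null.
  have hnull : ∀ᵐ w : ℝ, Real.cos (t * w) ≠ 1 := by
    have hc : Set.Countable {w : ℝ | Real.cos (t * w) = 1} := by
      refine (Set.countable_range fun n : ℤ => (n : ℝ) * (2 * Real.pi) / t).mono ?_
      rintro w (hw : Real.cos (t * w) = 1)
      obtain ⟨n, hn⟩ := (Real.cos_eq_one_iff _).mp hw
      exact ⟨n, by simp only [hn]; field_simp⟩
    simpa [ae_iff] using hc.measure_zero volume
  have hzero : q =ᵐ[volume] 0 := by
    filter_upwards [hae, hnull] with w h2 h3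
    have : (Real.cos (t * w) - 1) * q w = 0 := by rw [sub_mul, one_mul]; exact sub_eq_zero.mpr h2
    exact (mul_eq_zero.mp this).resolve_left (sub_ne_zero.mpr h3)
  have := integral_congr_ae hzero
  rw [hq.integral_eq_one] at this
  simp at this

theorem IsSymmetricDensity.exists_tail_le {q : ℝ → ℝ} (hq : IsSymmetricDensity q) {ε : ℝ}
    (hε : 0 < ε) : ∃ R : ℝ, 0 < R ∧ ∫ w, {w : ℝ | R < |w|}.indicator 1 w * q w ≤ ε := by
  have hlim : Tendsto (fun n : ℕ => ∫ w, {w : ℝ | (n : ℝ) < |w|}.indicator 1 w * q w) atTop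
      (𝓝 (∫ _ : ℝ, (0 : ℝ))) := by
    refine tendsto_integral_of_dominated_convergence q (fun n => ?_) hq.integrable (fun n => ?_) ?_
    · exact ((measurable_one.indicator (measurableSet_lt measurable_const
        measurable_norm)).mul hq.measurable).aestronglyMeasurable
    · refine Eventually.of_forall fun w => ?_
      rw [Real.norm_eq_abs, abs_mul, abs_of_nonneg (hq.nonneg w)]
      refine mul_le_of_le_one_left (hq.nonneg w) ?_
      rw [Set.indicator_apply]; split_ifs <;> simp
    · refine Eventually.of_forall fun w => tendsto_const_nhds.congr' ?_
      filter_upwards [eventually_ge_atTop ⌈|w|⌉₊] with n hn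
      rw [Set.indicator_of_notMem, zero_mul]
      simpa using Nat.ceil_le.mp hn
  rw [integral_zero] at hlim
  obtain ⟨n, hn, hn0⟩ := ((hlim.eventually_lt_const hε).and (eventually_gt_atTop 0)).exists
  exact ⟨n, by exact_mod_cast hn0, hn.le⟩

/-! ### Acceptance probabilities and rescaled proposals -/

theorem acceptProb_mem {π : ℝ → ℝ} (hπ : ∀ x, 0 < π x) (x y : ℝ) :
    acceptProb π x y ∈ Set.Icc (0 : ℝ) 1 :=
  ⟨le_min zero_le_one (div_pos (hπ y) (hπ x)).le, min_le_left _ _⟩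

theorem abs_acceptProb_le {π : ℝ → ℝ} (hπ : ∀ x, 0 < π x) (x y : ℝ) : |acceptProb π x y| ≤ 1 := by
  obtain ⟨h1, h2⟩ := acceptProb_mem hπ x y
  rwa [abs_of_nonneg h1]

theorem measurable_of_log_uniformContinuous {π : ℝ → ℝ} (hπ : ∀ x, 0 < π x)
    (hu : UniformContinuous (fun x => Real.log (π x))) : Measurable π := by
  have : π = fun x => Real.exp (Real.log (π x)) := by
    funext x; rw [Real.exp_log (hπ x)]
  rw [this]
  exact (Real.continuous_exp.comp hu.continuous).measurable

theorem measurable_acceptProb {π : ℝ → ℝ} (hπ : Measurable π) (x : ℝ) :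
    Measurable (acceptProb π x) :=
  measurable_const.min (hπ.div_const _)

/-- Rejection is uniformly unlikely for small proposal scales. -/
theorem exists_rejection_le {π q : ℝ → ℝ} (hπ : ∀ x, 0 < π x)
    (hu : UniformContinuous (fun x => Real.log (π x))) (hq : IsSymmetricDensity q)
    {ε : ℝ} (hε : 0 < ε) :
    ∃ ρ₀ : ℝ, 0 < ρ₀ ∧ ∀ ρ, 0 < ρ → ρ < ρ₀ → ∀ x,
      ∫ w, (1 - acceptProb π x (x + ρ * w)) * q w ≤ ε := by
  obtain ⟨R, hR, htail⟩ := hq.exists_tail_le (half_pos hε)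
  obtain ⟨δ, hδ, hlog⟩ := Metric.uniformContinuous_iff.mp hu (ε / 2) (half_pos hε)
  have hπm := measurable_of_log_uniformContinuous hπ hu
  -- For |w| ≤ R the move is shorter than δ, so log π drops by less than ε/2; the tail of `q` covers
  -- the rest.
  refine ⟨δ / R, by positivity, fun ρ hρ hρ' x => ?_⟩
  rw [lt_div_iff₀ hR] at hρ'
  have hpt : ∀ w, 1 - acceptProb π x (x + ρ * w) ≤ ε / 2 + {w : ℝ | R < |w|}.indicator 1 w := by
    intro w
    rcases lt_or_ge R |w| with hw | hw
    · rw [Set.indicator_of_mem (show w ∈ {w : ℝ | R < |w|} from hw), Pi.one_apply]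
      linarith [(acceptProb_mem hπ x (x + ρ * w)).1]
    · rw [Set.indicator_of_notMem (show w ∉ {w : ℝ | R < |w|} from not_lt.mpr hw), add_zero]
      have hd : dist (x + ρ * w) x < δ := by
        rw [Real.dist_eq, add_sub_cancel_left, abs_mul, abs_of_pos hρ]
        exact (mul_le_mul_of_nonneg_left hw hρ.le).trans_lt hρ'
      have h1 := hlog hd
      rw [Real.dist_eq, ← Real.log_div (hπ _).ne' (hπ _).ne'] at h1
      have h2 := (abs_lt.mp h1).1
      have h3 := Real.log_le_sub_one_of_pos (div_pos (hπ (x + ρ * w)) (hπ x))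
      have h4 : 1 - ε / 2 ≤ acceptProb π x (x + ρ * w) := le_min (by linarith) (by linarith)
      linarith
  have hind : Integrable (fun w => {w : ℝ | R < |w|}.indicator (1 : ℝ → ℝ) w * q w) := by
    refine hq.integrable_mul (C := 1)
      (measurable_one.indicator (measurableSet_lt measurable_const measurable_norm)) fun w => ?_
    rw [Set.indicator_apply]; split_ifs <;> simp
  calc ∫ w, (1 - acceptProb π x (x + ρ * w)) * q w
      ≤ ∫ w, (ε / 2 * q w + {w : ℝ | R < |w|}.indicator 1 w * q w) := by
        refine integral_mono ?_ ((hq.integrable.const_mul _).add hind) fun w => ?_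
        · refine hq.integrable_mul (C := 1) (measurable_const.sub
            ((measurable_acceptProb hπm x).comp (by fun_prop))) fun w => ?_
          obtain ⟨h1, h2⟩ := acceptProb_mem hπ x (x + ρ * w)
          rw [abs_of_nonneg (by linarith)]; linarith
        · simp only [← add_mul]
          exact mul_le_mul_of_nonneg_right (hpt w) (hq.nonneg w)
    _ = ε / 2 + ∫ w, {w : ℝ | R < |w|}.indicator 1 w * q w := by
        rw [integral_add (hq.integrable.const_mul _) hind, integral_const_mul, hq.integral_eq_one,
          mul_one]
    _ ≤ ε := by linarith

theorem IsSymmetricDensity.scaledProposal {q : ℝ → ℝ} (hq : IsSymmetricDensity q) {θ s : ℝ}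
    (h : 0 < θ * s) : IsSymmetricDensity (scaledProposal q θ s) := by
  have hr : 0 < (Real.sqrt (θ * s))⁻¹ := inv_pos.mpr (Real.sqrt_pos.mpr h)
  refine ⟨(hq.measurable.comp (by fun_prop)).const_mul _, fun z => mul_nonneg hr.le (hq.nonneg _),
    ?_, fun z => ?_⟩
  · simp only [AdaptiveMetropolis.scaledProposal]
    rw [integral_const_mul, Measure.integral_comp_mul_left q, hq.integral_eq_one, smul_eq_mul,
      mul_one, inv_inv, abs_of_pos (inv_pos.mp hr), inv_mul_cancel₀ (inv_pos.mp hr).ne']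
  · simp only [AdaptiveMetropolis.scaledProposal, mul_neg, hq.symmetric]

theorem integral_mul_scaledProposal_sub {θ s : ℝ} (h : 0 < θ * s) (q f : ℝ → ℝ) (x : ℝ) :
    ∫ y, f y * scaledProposal q θ s (y - x) = ∫ w, f (x + Real.sqrt (θ * s) * w) * q w := by
  have hr : 0 < Real.sqrt (θ * s) := Real.sqrt_pos.mpr h
  set ρ := Real.sqrt (θ * s) with hρ
  have h1 : ∫ y, f y * scaledProposal q θ s (y - x)
      = ∫ z, f (x + z) * scaledProposal q θ s z := by
    rw [← integral_sub_right_eq_self (fun z => f (x + z) * scaledProposal q θ s z) x]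
    simp
  have h2 := Measure.integral_comp_mul_left (fun w => f (x + ρ * w) * q w) ρ⁻¹
  rw [h1]
  calc ∫ z, f (x + z) * scaledProposal q θ s z
      = ρ⁻¹ * ∫ z, f (x + ρ * (ρ⁻¹ * z)) * q (ρ⁻¹ * z) := by
        rw [← integral_const_mul]
        refine integral_congr_ae (Eventually.of_forall fun z => ?_)
        simp only [scaledProposal, ← hρ, mul_inv_cancel_left₀ hr.ne']
        ring
    _ = _ := by
        rw [h2, inv_inv, abs_of_pos hr, smul_eq_mul, inv_mul_cancel_left₀ hr.ne']

/-! ### Integration against the Metropolis law -/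

section MetropolisLaw

variable {π q : ℝ → ℝ}

theorem IsSymmetricDensity.integral_mul_sub_mem (hq : IsSymmetricDensity q) (x : ℝ) {f : ℝ → ℝ}
    (hf : Measurable f) (hf01 : ∀ y, f y ∈ Set.Icc (0 : ℝ) 1) :
    ∫ y, f y * q (y - x) ∈ Set.Icc (0 : ℝ) 1 := by
  have h1 : Integrable (fun y => q (y - x)) := hq.integrable.comp_sub_right x
  refine ⟨integral_nonneg fun y => mul_nonneg (hf01 y).1 (hq.nonneg _), ?_⟩
  have h2 : ∫ y, q (y - x) = 1 := by rw [integral_sub_right_eq_self, hq.integral_eq_one]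
  rw [← h2]
  refine integral_mono (h1.bdd_mul (c := 1) hf.aestronglyMeasurable
    (Eventually.of_forall fun y => ?_)) h1 fun y => mul_le_of_le_one_left (hq.nonneg _) (hf01 y).2
  rw [Real.norm_eq_abs, abs_of_nonneg (hf01 y).1]
  exact (hf01 y).2

theorem integrable_acceptProb_mul (hπ : ∀ x, 0 < π x) (hπm : Measurable π)
    (hq : IsSymmetricDensity q) (x : ℝ) :
    Integrable (fun y => acceptProb π x y * q (y - x)) :=
  (hq.integrable.comp_sub_right x).bdd_mul (c := 1) (measurable_acceptProb hπm x).aestronglyMeasurable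
    (Eventually.of_forall fun y => abs_acceptProb_le hπ x y)

theorem isProbabilityMeasure_metropolisLaw (hπ : ∀ x, 0 < π x) (hπm : Measurable π)
    (hq : IsSymmetricDensity q) (x : ℝ) : IsProbabilityMeasure (metropolisLaw π q x) := by
  obtain ⟨h0, h1⟩ := hq.integral_mul_sub_mem x (measurable_acceptProb hπm x) (acceptProb_mem hπ x)
  constructor
  rw [metropolisLaw, Measure.add_apply, Measure.smul_apply, measure_univ, smul_eq_mul, mul_one,
    withDensity_apply _ MeasurableSet.univ, setLIntegral_univ,
    ← ofReal_integral_eq_lintegral_ofReal (integrable_acceptProb_mul hπ hπm hq x)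
      (Eventually.of_forall fun y => mul_nonneg (acceptProb_mem hπ x y).1 (hq.nonneg _)),
    ← ENNReal.ofReal_add (by linarith) h0, sub_add_cancel, ENNReal.ofReal_one]

theorem integral_metropolisLaw (hπ : ∀ x, 0 < π x) (hπm : Measurable π)
    (hq : IsSymmetricDensity q) (x : ℝ) {f : ℝ → ℝ} (hf : Measurable f) {C : ℝ}
    (hC : ∀ y, |f y| ≤ C) :
    ∫ y, f y ∂metropolisLaw π q x
      = ∫ y, (f y * acceptProb π x y + f x * (1 - acceptProb π x y)) * q (y - x) := by
  have hqi : Integrable (fun y => q (y - x)) := hq.integrable.comp_sub_right x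
  have hqi1 : ∫ y, q (y - x) = 1 := by rw [integral_sub_right_eq_self, hq.integral_eq_one]
  have ha := integrable_acceptProb_mul hπ hπm hq x
  have hfa : Integrable (fun y => f y * (acceptProb π x y * q (y - x))) :=
    ha.bdd_mul hf.aestronglyMeasurable (Eventually.of_forall hC)
  obtain ⟨h0, h1⟩ := hq.integral_mul_sub_mem x (measurable_acceptProb hπm x) (acceptProb_mem hπ x)
  have hm : Measurable fun y => ENNReal.ofReal (acceptProb π x y * q (y - x)) :=
    ((measurable_acceptProb hπm x).mul (hq.measurable.comp (by fun_prop))).ennreal_ofReal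
  have := isProbabilityMeasure_metropolisLaw hπ hπm hq x
  have hint : Integrable f (metropolisLaw π q x) :=
    Integrable.of_bound hf.aestronglyMeasurable C (Eventually.of_forall hC)
  rw [metropolisLaw] at hint
  rw [metropolisLaw, integral_add_measure (hint.mono_measure (Measure.le_add_right le_rfl))
    (hint.mono_measure (Measure.le_add_left le_rfl)), integral_smul_measure, integral_dirac,
    ENNReal.toReal_ofReal (by linarith),
    integral_withDensity_eq_integral_toReal_smul hm (Eventually.of_forall fun _ => ENNReal.ofReal_lt_top)]
  have h2 : ∀ y, (ENNReal.ofReal (acceptProb π x y * q (y - x))).toReal • f y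
      = f y * (acceptProb π x y * q (y - x)) := fun y => by
    rw [ENNReal.toReal_ofReal (mul_nonneg (acceptProb_mem hπ x y).1 (hq.nonneg _)), smul_eq_mul,
      mul_comm]
  simp only [h2]
  have h3 : ∫ y, (f y * acceptProb π x y + f x * (1 - acceptProb π x y)) * q (y - x)
      = ∫ y, (f y * (acceptProb π x y * q (y - x))
        + f x * (q (y - x) - acceptProb π x y * q (y - x))) := by
    refine integral_congr_ae (Eventually.of_forall fun y => ?_)
    simp only; ring
  have h4 : Integrable (fun y => f x * (q (y - x) - acceptProb π x y * q (y - x))) :=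
    (hqi.sub ha).const_mul _
  rw [h3, integral_add hfa h4, integral_const_mul, integral_sub hqi ha,
    hqi1, smul_eq_mul]
  ring

/-- If every proposal were accepted, the standardised move would be √θ·w whatever `s` is, and
symmetry would give exactly the factor `cosTransform`. A rejection changes the cosine by at most 2,
hence the rejection bound ε/2. -/
theorem exists_integral_cos_metropolisLaw_le (hπ : ∀ x, 0 < π x)
    (hu : UniformContinuous (fun x => Real.log (π x))) (hq : IsSymmetricDensity q)
    {θ : ℝ} (hθ : 0 < θ) {ε : ℝ} (hε : 0 < ε) :
    ∃ b : ℝ, 0 < b ∧ ∀ s, 0 < s → s < b → ∀ x m,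
      ∫ y, Real.cos ((y - m) / Real.sqrt s / 2) ∂metropolisLaw π (scaledProposal q θ s) x
        ≤ Real.cos ((x - m) / Real.sqrt s / 2) * cosTransform q (Real.sqrt θ / 2) + ε := by
  obtain ⟨ρ₀, hρ₀, hrej⟩ := exists_rejection_le hπ hu hq (half_pos hε)
  have hπm := measurable_of_log_uniformContinuous hπ hu
  refine ⟨ρ₀ ^ 2 / θ, by positivity, fun s hs hsb x m => ?_⟩
  have hθs : 0 < θ * s := mul_pos hθ hs
  have hss : 0 < Real.sqrt s := Real.sqrt_pos.mpr hs
  have hρ : Real.sqrt (θ * s) < ρ₀ := by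
    rw [Real.sqrt_lt' hρ₀]
    rw [lt_div_iff₀ hθ] at hsb; linarith
  have hrej := hrej _ (Real.sqrt_pos.mpr hθs) hρ x
  rw [integral_metropolisLaw hπ hπm (hq.scaledProposal hθs) x (by fun_prop)
    (fun y => Real.abs_cos_le_one _), integral_mul_scaledProposal_sub hθs q]
  have hacc : Measurable fun w => acceptProb π x (x + Real.sqrt (θ * s) * w) :=
    (measurable_acceptProb hπm x).comp (by fun_prop)
  have hi1 : Integrable fun w =>
      Real.cos ((x - m) / Real.sqrt s / 2 + Real.sqrt θ / 2 * w) * q w :=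
    hq.integrable_mul (by fun_prop) fun z => Real.abs_cos_le_one _
  have hi2 : Integrable fun w => (1 - acceptProb π x (x + Real.sqrt (θ * s) * w)) * q w := by
    refine hq.integrable_mul (C := 1) (measurable_const.sub hacc) fun w => ?_
    obtain ⟨h1, h2⟩ := acceptProb_mem hπ x (x + Real.sqrt (θ * s) * w)
    rw [abs_of_nonneg (by linarith)]; linarith
  calc _ ≤ ∫ w, (Real.cos ((x - m) / Real.sqrt s / 2 + Real.sqrt θ / 2 * w) * q w
        + 2 * ((1 - acceptProb π x (x + Real.sqrt (θ * s) * w)) * q w)) := by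
        refine integral_mono ?_ (hi1.add (hi2.const_mul 2)) fun w => ?_
        · refine hq.integrable_mul (C := 1) ((by fun_prop : Measurable _).mul hacc |>.add
            (measurable_const.mul (measurable_const.sub hacc))) fun w => ?_
          obtain ⟨h1, h2⟩ := acceptProb_mem hπ x (x + Real.sqrt (θ * s) * w)
          refine (abs_add_le _ _).trans ?_
          rw [abs_mul, abs_mul, abs_of_nonneg h1, abs_of_nonneg (sub_nonneg.mpr h2)]
          have h3 := mul_le_mul_of_nonneg_right (Real.abs_cos_le_one
            ((x + Real.sqrt (θ * s) * w - m) / Real.sqrt s / 2)) h1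
          have h4 := mul_le_mul_of_nonneg_right (Real.abs_cos_le_one
            ((x - m) / Real.sqrt s / 2)) (sub_nonneg.mpr h2)
          linarith
        · have hcos : (x + Real.sqrt (θ * s) * w - m) / Real.sqrt s / 2
              = (x - m) / Real.sqrt s / 2 + Real.sqrt θ / 2 * w := by
            rw [Real.sqrt_mul hθ.le]; field_simp; ring
          simp only [hcos]
          obtain ⟨h1, h2⟩ := acceptProb_mem hπ x (x + Real.sqrt (θ * s) * w)
          set a := acceptProb π x (x + Real.sqrt (θ * s) * w)
          rw [← mul_assoc, ← add_mul]
          refine mul_le_mul_of_nonneg_right ?_ (hq.nonneg w)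
          have h3 := Real.neg_one_le_cos ((x - m) / Real.sqrt s / 2 + Real.sqrt θ / 2 * w)
          have h4 := Real.cos_le_one ((x - m) / Real.sqrt s / 2)
          nlinarith
    _ ≤ _ := by
        rw [integral_add hi1 (hi2.const_mul 2), hq.integral_cos_add_mul, integral_const_mul]
        linarith

end MetropolisLaw

/-! ### Conditional laws and martingale convergence -/

/-- A conditional law known on events determines conditional expectations of bounded functionals. -/
theorem condExp_ae_eq_integral_of_law {Ω : Type*} {m m0 : MeasurableSpace Ω} (hm : m ≤ m0)
    {P : Measure Ω} [IsProbabilityMeasure P] {X : Ω → ℝ} (hX : Measurable X) {κ : Ω → Measure ℝ}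
    (hκ : ∀ ω, IsProbabilityMeasure (κ ω))
    (hlaw : ∀ A : Set ℝ, MeasurableSet A →
      P[(X ⁻¹' A).indicator (fun _ => (1 : ℝ)) | m] =ᵐ[P] fun ω => (κ ω).real A)
    {f : Ω × ℝ → ℝ} (hf : @StronglyMeasurable (Ω × ℝ) ℝ _ (@Prod.instMeasurableSpace Ω ℝ m _) f)
    {C : ℝ} (hC : ∀ z, |f z| ≤ C) :
    P[fun ω => f (ω, X ω) | m] =ᵐ[P] fun ω => ∫ y, f (ω, y) ∂κ ω := by
  have hid : @Measurable Ω Ω m0 m id := measurable_id'' hm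
  have hprod : @Measurable Ω (Ω × ℝ) m0 (@Prod.instMeasurableSpace Ω ℝ m _)
      (fun ω => (id ω, X ω)) := hid.prodMk hX
  have hcomap : MeasurableSpace.comap id m = m := MeasurableSpace.comap_id
  have hint : Integrable (fun ω => f (id ω, X ω)) P :=
    Integrable.of_bound (hf.comp_measurable hprod).aestronglyMeasurable C
      (Eventually.of_forall fun ω => hC _)
  have h1 := ProbabilityTheory.condExp_prod_ae_eq_integral_condDistrib (mβ := m) hid hX.aemeasurable
    hf hint
  rw [hcomap] at h1
  -- Countably many half-lines determine a probability measure on ℝ, so one null set suffices and no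
  -- measurability of κ is needed.
  have h2 : ∀ᵐ ω ∂P, ∀ a : ℚ,
      ((@ProbabilityTheory.condDistrib Ω Ω ℝ _ _ _ m0 m X id P _) ω).real (Set.Iic (a : ℝ))
        = (κ ω).real (Set.Iic (a : ℝ)) := by
    rw [ae_all_iff]
    intro a
    have h3 := ProbabilityTheory.condDistrib_ae_eq_condExp (mβ := m) (μ := P) hid hX
      (measurableSet_Iic (a := (a : ℝ)))
    rw [hcomap] at h3
    exact h3.trans (hlaw _ measurableSet_Iic)
  filter_upwards [h1, h2] with ω h1 h2
  rw [show (fun ω => f (ω, X ω)) = fun ω => f (id ω, X ω) from rfl, h1]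
  have hκω := hκ ω
  have heq : (@ProbabilityTheory.condDistrib Ω Ω ℝ _ _ _ m0 m X id P _) ω = κ ω := by
    refine ext_of_generate_finite _ (Real.borel_eq_generateFrom_Iic_rat ▸ BorelSpace.measurable_eq)
      Real.isPiSystem_Iic_rat ?_ (by simp)
    intro s hs
    obtain ⟨a, rfl⟩ := Set.mem_iUnion.mp hs
    exact (measureReal_eq_measureReal_iff).mp (h2 a)
  simp only [id, heq]

/-- Weighted sums of bounded martingale differences with square-summable weights converge. -/
theorem ae_exists_tendsto_sum_sub_condExp {Ω : Type*} {m0 : MeasurableSpace Ω} {P : Measure Ω}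
    [IsProbabilityMeasure P] {ℱ : Filtration ℕ m0} {ξ : ℕ → Ω → ℝ} {c : ℕ → ℝ}
    (hξ : ∀ k, StronglyMeasurable[ℱ (k + 1)] (ξ k)) (hb : ∀ k ω, |ξ k ω| ≤ 1)
    (hc : Summable fun k => c k ^ 2) :
    ∀ᵐ ω ∂P, ∃ l, Tendsto
      (fun n => ∑ k ∈ Finset.range n, c k * (ξ k ω - (P[ξ k | ℱ k]) ω)) atTop (𝓝 l) := by
  set D : ℕ → Ω → ℝ := fun k => c k • (ξ k - P[ξ k | ℱ k]) with hD
  set N : ℕ → Ω → ℝ := fun n => ∑ k ∈ Finset.range n, D k with hN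
  have hNs : ∀ n, N (n + 1) = N n + D n := fun n => Finset.sum_range_succ _ _
  have hξi : ∀ k, Integrable (ξ k) P := fun k =>
    Integrable.of_bound ((hξ k).mono (ℱ.le _)).aestronglyMeasurable 1 (Eventually.of_forall (hb k))
  have hDm : ∀ k, StronglyMeasurable[ℱ (k + 1)] (D k) := fun k =>
    ((hξ k).sub (stronglyMeasurable_condExp.mono (ℱ.mono k.le_succ))).const_smul _
  have hDi : ∀ k, Integrable (D k) P := fun k => ((hξi k).sub integrable_condExp).smul _
  have hDb : ∀ k, ∀ᵐ ω ∂P, |D k ω| ≤ 2 * |c k| := by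
    intro k
    filter_upwards [ae_bdd_abs_condExp_of_ae_bdd_abs (m := ℱ k) (Eventually.of_forall (hb k))]
      with ω hω
    simp only [hD, Pi.smul_apply, Pi.sub_apply, smul_eq_mul, abs_mul]
    have h1 := abs_sub (ξ k ω) ((P[ξ k | ℱ k]) ω)
    have h2 := hb k ω
    nlinarith [abs_nonneg (c k)]
  have hDc : ∀ k, P[D k | ℱ k] =ᵐ[P] 0 := by
    intro k
    refine (condExp_smul _ _ _).trans ?_
    filter_upwards [condExp_sub (hξi k) (integrable_condExp (m := ℱ k) (f := ξ k)) (ℱ k)] with ω h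
    rw [Pi.smul_apply, h, Pi.sub_apply,
      condExp_of_stronglyMeasurable (ℱ.le k) stronglyMeasurable_condExp integrable_condExp]
    simp
  have hNm : StronglyAdapted ℱ N := by
    intro n
    refine Finset.stronglyMeasurable_sum _ fun k hk => (hDm k).mono (ℱ.mono ?_)
    have := Finset.mem_range.mp hk
    omega
  have hNi : ∀ n, Integrable (N n) P := fun n => integrable_finsetSum' _ fun k _ => hDi k
  have hNb : ∀ n, ∃ B, ∀ᵐ ω ∂P, ‖N n ω‖ ≤ B := by
    intro n
    refine ⟨∑ k ∈ Finset.range n, 2 * |c k|, ?_⟩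
    filter_upwards [ae_all_iff.mpr hDb] with ω hω
    simp only [hN, Finset.sum_apply]
    exact norm_sum_le_of_le _ fun k _ => hω k
  have hmart : Martingale N ℱ P := by
    refine martingale_of_condExp_sub_eq_zero_nat hNm hNi fun i => ?_
    rw [hNs, add_sub_cancel_left]
    exact hDc i
  have hN2i : ∀ n, Integrable (fun ω => N n ω * N n ω) P := fun n => by
    obtain ⟨B, hB⟩ := hNb n
    exact (hNi n).bdd_mul (hNi n).aestronglyMeasurable hB
  have hNDi : ∀ n, Integrable (N n * D n) P := fun n => by
    obtain ⟨B, hB⟩ := hNb n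
    exact (hDi n).bdd_mul (hNi n).aestronglyMeasurable hB
  have hD2i : ∀ n, Integrable (fun ω => D n ω * D n ω) P := fun n =>
    (hDi n).bdd_mul (hDi n).aestronglyMeasurable (hDb n)
  have hND : ∀ n, ∫ ω, (N n * D n) ω ∂P = 0 := by
    intro n
    have h1 : P[N n * D n | ℱ n] =ᵐ[P] 0 := by
      filter_upwards [condExp_mul_of_stronglyMeasurable_left (hNm n) (hNDi n) (hDi n), hDc n]
        with ω h1 h2
      rw [h1, Pi.mul_apply, h2]; simp
    rw [← integral_condExp (ℱ.le n), integral_congr_ae h1]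
    simp
  have hN2 : ∀ n, ∫ ω, N n ω * N n ω ∂P ≤ ∑ k ∈ Finset.range n, 4 * c k ^ 2 := by
    intro n
    induction n with
    | zero => simp [hN]
    | succ n ih =>
      have h1 : ∀ ω, N (n + 1) ω * N (n + 1) ω
          = N n ω * N n ω + (2 * (N n * D n) ω + D n ω * D n ω) := by
        intro ω; rw [hNs]; simp only [Pi.add_apply, Pi.mul_apply]; ring
      have h2 : ∫ ω, D n ω * D n ω ∂P ≤ 4 * c n ^ 2 := by
        have : ∫ ω, D n ω * D n ω ∂P ≤ ∫ _, 4 * c n ^ 2 ∂P := by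
          refine integral_mono_ae (hD2i n) (integrable_const _) ?_
          filter_upwards [hDb n] with ω hω
          nlinarith [abs_mul_abs_self (D n ω), abs_mul_abs_self (c n), abs_nonneg (D n ω)]
        simpa using this
      have h3 : Integrable (fun ω => 2 * (N n * D n) ω + D n ω * D n ω) P :=
        ((hNDi n).const_mul 2).add (hD2i n)
      simp only [h1]
      rw [integral_add (hN2i n) h3, integral_add ((hNDi n).const_mul 2) (hD2i n),
        integral_const_mul, hND, Finset.sum_range_succ]
      linarith
  have hT : 0 ≤ 1 + ∑' k, 4 * c k ^ 2 :=
    add_nonneg zero_le_one (tsum_nonneg fun k => by positivity)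
  have hbdd : ∀ n, eLpNorm (N n) 1 P ≤ ((1 + ∑' k, 4 * c k ^ 2).toNNReal : NNReal) := by
    intro n
    rw [eLpNorm_one_eq_lintegral_enorm, ← ofReal_integral_norm_eq_lintegral_enorm (hNi n)]
    refine ENNReal.ofReal_le_ofReal ?_
    -- The L² bound from orthogonal increments gives an L¹ bound through |x| ≤ 1 + x².
    have h1 : ∫ ω, ‖N n ω‖ ∂P ≤ ∫ ω, (1 + N n ω * N n ω) ∂P := by
      refine integral_mono (hNi n).norm ((integrable_const _).add (hN2i n)) fun ω => ?_
      simp only [Real.norm_eq_abs]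
      nlinarith [abs_mul_abs_self (N n ω), sq_nonneg (|N n ω| - 1)]
    rw [integral_add (integrable_const _) (hN2i n)] at h1
    have h2 := (hc.mul_left 4).sum_le_tsum (Finset.range n) (fun k _ => by positivity)
    have h3 := hN2 n
    simp only [integral_const, probReal_univ, smul_eq_mul, mul_one] at h1
    linarith
  filter_upwards [hmart.submartingale.exists_ae_tendsto_of_bdd hbdd] with ω ⟨l, hl⟩
  refine ⟨l, hl.congr fun n => ?_⟩
  simp [hN, hD]

/-! ### The adaptive Metropolis process -/

theorem history_mono {Ω : Type*} (X M S : ℕ → Ω → ℝ) : Monotone (history X M S) :=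
  fun _ _ h => biSup_mono fun _ hk => ⟨hk.1, hk.2.trans h⟩

theorem measurable_history {Ω : Type*} (X M S : ℕ → Ω → ℝ) {k n : ℕ} (hk : 1 ≤ k) (hkn : k ≤ n) :
    Measurable[history X M S n] (fun ω => (X k ω, M k ω, S k ω)) :=
  Measurable.of_comap_le (le_biSup (fun k =>
    MeasurableSpace.comap (fun ω => (X k ω, M k ω, S k ω)) inferInstance)
    (show k ∈ Set.Icc 1 n from ⟨hk, hkn⟩))

/-- The cosine of the standardised innovation. -/
def cosInnovation {Ω : Type*} (X M S : ℕ → Ω → ℝ) (n : ℕ) (ω : Ω) : ℝ :=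
  Real.cos ((X (n + 1) ω - M n ω) / Real.sqrt (S n ω) / 2)

theorem measurable_cosInnovation {Ω : Type*} (X M S : ℕ → Ω → ℝ) {n : ℕ} (hn : 1 ≤ n) :
    Measurable[history X M S (n + 1)] (cosInnovation X M S n) := by
  have h1 := measurable_history X M S (n := n + 1) hn (by omega)
  have h2 := measurable_history X M S (k := n + 1) (n := n + 1) (by omega) le_rfl
  have hg : Measurable fun p : (ℝ × ℝ × ℝ) × (ℝ × ℝ × ℝ) =>
      Real.cos ((p.1.1 - p.2.2.1) / Real.sqrt p.2.2.2 / 2) := by fun_prop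
  have h3 := hg.comp (h2.prodMk h1)
  exact h3

namespace IsAMProcess

variable {Ω : Type*} [MeasurableSpace Ω] {P : Measure Ω} {π q : ℝ → ℝ} {θ : ℝ} {η : ℕ → ℝ}
  {x₁ m₁ s₁ : ℝ} {X M S : ℕ → Ω → ℝ}

theorem S_pos (h : IsAMProcess P π q θ η x₁ m₁ s₁ X M S)
    (hη : ∀ n, 2 ≤ n → η n ∈ Set.Ioo (0 : ℝ) 1) (hs : 0 < s₁) {n : ℕ} (hn : 1 ≤ n) (ω : Ω) :
    0 < S n ω := by
  induction n, hn using Nat.le_induction with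
  | base => rwa [h.S_one]
  | succ n hn ih =>
    obtain ⟨h0, h1⟩ := hη (n + 1) (by omega)
    rw [h.S_succ n hn]
    have := mul_pos (sub_pos.mpr h1) ih
    positivity

theorem measurable_M (h : IsAMProcess P π q θ η x₁ m₁ s₁ X M S) {n : ℕ} (hn : 1 ≤ n) :
    Measurable (M n) := by
  induction n, hn using Nat.le_induction with
  | base => rw [funext h.M_one]; exact measurable_const
  | succ n hn ih =>
    rw [funext (h.M_succ n hn)]
    exact (ih.const_mul _).add ((h.measurable_X _ (by omega)).const_mul _)

theorem measurable_S (h : IsAMProcess P π q θ η x₁ m₁ s₁ X M S) {n : ℕ} (hn : 1 ≤ n) :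
    Measurable (S n) := by
  induction n, hn using Nat.le_induction with
  | base => rw [funext h.S_one]; exact measurable_const
  | succ n hn ih =>
    rw [funext (h.S_succ n hn)]
    exact (ih.const_mul _).add
      ((((h.measurable_X _ (by omega)).sub (h.measurable_M hn)).pow_const 2).const_mul _)

theorem history_le (h : IsAMProcess P π q θ η x₁ m₁ s₁ X M S) (n : ℕ) :
    history X M S n ≤ (inferInstance : MeasurableSpace Ω) :=
  iSup₂_le fun k hk => Measurable.comap_le
    ((h.measurable_X k hk.1).prodMk ((h.measurable_M hk.1).prodMk (h.measurable_S hk.1)))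

/-- The history of the process from time `1` on. -/
def filtration (h : IsAMProcess P π q θ η x₁ m₁ s₁ X M S) :
    Filtration ℕ (inferInstance : MeasurableSpace Ω) where
  seq n := history X M S (n + 1)
  mono' := fun _ _ hij => history_mono X M S (by omega)
  le' := fun n => h.history_le (n + 1)

theorem condExp_cosInnovation (h : IsAMProcess P π q θ η x₁ m₁ s₁ X M S) [IsProbabilityMeasure P]
    (hη : ∀ n, 2 ≤ n → η n ∈ Set.Ioo (0 : ℝ) 1) (hs : 0 < s₁) (hθ : 0 < θ)
    (hπ : ∀ x, 0 < π x) (hπm : Measurable π) (hq : IsSymmetricDensity q) {n : ℕ} (hn : 1 ≤ n) :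
    P[cosInnovation X M S n | history X M S n] =ᵐ[P] fun ω =>
      ∫ y, Real.cos ((y - M n ω) / Real.sqrt (S n ω) / 2)
        ∂metropolisLaw π (scaledProposal q θ (S n ω)) (X n ω) := by
  have hXMS := measurable_history X M S hn le_rfl
  refine condExp_ae_eq_integral_of_law (C := 1)
    (f := fun z => Real.cos ((z.2 - M n z.1) / Real.sqrt (S n z.1) / 2))
    (h.history_le n) (h.measurable_X (n + 1) (by omega))
    (fun ω => isProbabilityMeasure_metropolisLaw hπ hπm
      (hq.scaledProposal (mul_pos hθ (h.S_pos hη hs hn ω))) _)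
    (h.X_succ n hn) ?_ (fun z => Real.abs_cos_le_one _)
  have hg : Measurable fun p : ℝ × (ℝ × ℝ × ℝ) =>
      Real.cos ((p.1 - p.2.2.1) / Real.sqrt p.2.2.2 / 2) := by fun_prop
  let _ : MeasurableSpace Ω := history X M S n
  exact (hg.comp (measurable_snd.prodMk (hXMS.comp measurable_fst))).stronglyMeasurable

/-- The logarithmic scale increases by at least the potential increment plus the innovation. -/
theorem log_S_step (h : IsAMProcess P π q θ η x₁ m₁ s₁ X M S)
    (hη : ∀ n, 2 ≤ n → η n ∈ Set.Ioo (0 : ℝ) 1) (hs : 0 < s₁) {A R : ℝ} (hA : 0 ≤ A)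
    (hR : 1 ≤ R) (hRA : 2 * A + 9 ≤ R ^ 2) {n : ℕ} (hn : 1 ≤ n) (hη' : η (n + 1) ≤ 1 / 2) (ω : Ω) :
    η (n + 1) * (potential A ((X (n + 1) ω - M (n + 1) ω) / Real.sqrt (S (n + 1) ω)) - 1
        - A * cosInnovation X M S n ω) - (2 * R ^ 4 + 2 * A * R ^ 3) * η (n + 1) ^ 2
      ≤ Real.log (S (n + 1) ω) - Real.log (S n ω) := by
  have hSn := h.S_pos hη hs hn ω
  have hsq : 0 < Real.sqrt (S n ω) := Real.sqrt_pos.mpr hSn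
  obtain ⟨h0, h1⟩ := hη (n + 1) (by omega)
  set e := η (n + 1)
  set Y := (X (n + 1) ω - M n ω) / Real.sqrt (S n ω) with hY
  have hr : 0 < 1 - e + e * Y ^ 2 := by nlinarith [mul_nonneg h0.le (sq_nonneg Y)]
  have hS : S (n + 1) ω = S n ω * (1 - e + e * Y ^ 2) := by
    have hYS : S n ω * Y ^ 2 = (X (n + 1) ω - M n ω) ^ 2 := by
      rw [hY, div_pow, Real.sq_sqrt hSn.le, mul_div_cancel₀ _ hSn.ne']
    rw [h.S_succ n hn, ← hYS]
    ring
  have hZ : (X (n + 1) ω - M (n + 1) ω) / Real.sqrt (S (n + 1) ω)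
      = (1 - e) * Y / Real.sqrt (1 - e + e * Y ^ 2) := by
    have hsr : Real.sqrt (1 - e + e * Y ^ 2) ≠ 0 := (Real.sqrt_pos.mpr hr).ne'
    have hXM : X (n + 1) ω - M (n + 1) ω = (1 - e) * (Y * Real.sqrt (S n ω)) := by
      rw [h.M_succ n hn, hY, div_mul_cancel₀ _ hsq.ne']; ring
    rw [hS, Real.sqrt_mul hSn.le, hXM]
    field_simp
  rw [hZ, hS, Real.log_mul hSn.ne' hr.ne', add_sub_cancel_left]
  exact log_scale_step hA hR hRA h0 hη' Y

end IsAMProcess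

end AdaptiveMetropolis

end

/-! ### Assembly of the lower bound -/

open AdaptiveMetropolis in
theorem mainTheorem3
    (π : ℝ → ℝ) (hπ_pos : ∀ x, 0 < π x)
    (hπ : UniformContinuous (fun x => Real.log (π x)))
    (q : ℝ → ℝ) (hq : AdaptiveMetropolis.IsSymmetricDensity q)
    (θ : ℝ) (hθ : 0 < θ)
    (η : ℕ → ℝ) (hη : ∀ n, 2 ≤ n → η n ∈ Set.Ioo (0 : ℝ) 1)
    (hη_ratio : Tendsto (fun n => η (n + 1) / η n) atTop (𝓝 1))
    (hη_sum : ¬ Summable (fun n => η (n + 2)))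
    (hη_sq : Summable (fun n => η (n + 2) ^ 2))
    (x₁ m₁ s₁ : ℝ) (hs₁ : 0 < s₁) :
    ∃ b : ℝ, 0 < b ∧
      ∀ (Ω : Type*) [MeasurableSpace Ω] (P : Measure Ω) [IsProbabilityMeasure P]
        (X M S : ℕ → Ω → ℝ),
        AdaptiveMetropolis.IsAMProcess P π q θ η x₁ m₁ s₁ X M S →
        ∀ᵐ ω ∂P, (b : EReal) ≤ liminf (fun n => ((S n ω : ℝ) : EReal)) atTop := by
  set φ := cosTransform q (Real.sqrt θ / 2) with hφ
  have hφ1 : φ < 1 := hq.cosTransform_lt_one (by have := Real.sqrt_pos.mpr hθ; positivity)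
  set A := 3 / (1 - φ) with hAdef
  have hA : 0 < A := div_pos (by norm_num) (by linarith)
  have hAφ : A * (1 - φ) = 3 := div_mul_cancel₀ _ (by linarith)
  obtain ⟨b, hb, hcos⟩ := exists_integral_cos_metropolisLaw_le hπ_pos hπ hq hθ
    (ε := 1 / (4 * A)) (by positivity)
  refine ⟨b / 2, half_pos hb, ?_⟩
  intro Ω _ P _ X M S h
  have hSpos : ∀ n ω, 0 < S (n + 1) ω := fun n ω => h.S_pos hη hs₁ (by omega) ω
  have he : ∀ n, η (n + 2) ∈ Set.Ioo (0 : ℝ) 1 := fun n => hη _ (by omega)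
  have he0 : Tendsto (fun n => η (n + 2)) atTop (𝓝 0) := by
    have := hη_sq.tendsto_atTop_zero.sqrt
    rw [Real.sqrt_zero] at this
    exact this.congr fun n => Real.sqrt_sq (he n).1.le
  -- Process time is shifted by one: index k stands for time k + 1, whose update carries the weight
  -- η (k + 2).
  have hmart := ae_exists_tendsto_sum_sub_condExp (P := P) (ℱ := h.filtration)
    (ξ := fun k => cosInnovation X M S (k + 1)) (c := fun k => A * η (k + 2))
    (fun k => (measurable_cosInnovation X M S (by omega)).stronglyMeasurable)
    (fun k ω => Real.abs_cos_le_one _)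
    (by simpa only [mul_pow] using hη_sq.mul_left (A ^ 2))
  have hcond : ∀ᵐ ω ∂P, ∀ n, (P[cosInnovation X M S (n + 1) | h.filtration n]) ω
      = ∫ y, Real.cos ((y - M (n + 1) ω) / Real.sqrt (S (n + 1) ω) / 2)
        ∂metropolisLaw π (scaledProposal q θ (S (n + 1) ω)) (X (n + 1) ω) :=
    ae_all_iff.mpr fun n => h.condExp_cosInnovation hη hs₁ hθ hπ_pos
      (measurable_of_log_uniformContinuous hπ_pos hπ) hq (by omega)
  filter_upwards [hmart, hcond] with ω ⟨l, hl⟩ hcond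
  have hR : 1 ≤ 2 * A + 9 := by linarith
  -- The constant C comes from `log_scale_step` with R = 2A + 9, for which 2A + 9 ≤ R².
  have hev := eventually_half_le_of_drift (S := fun n => S (n + 1) ω) (e := fun n => η (n + 2))
    (p := fun n => potential A ((X (n + 1) ω - M (n + 1) ω) / Real.sqrt (S (n + 1) ω)))
    (C := 2 * (2 * A + 9) ^ 4 + 2 * A * (2 * A + 9) ^ 3) hb (fun n => hSpos n ω)
    (fun n => abs_potential_le hA.le _) he
    ((tendsto_add_atTop_iff_nat 2).mpr hη_ratio) hη_sum he0 hl
    (fun n => by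
      rw [h.S_succ (n + 1) (by omega)]
      have := mul_nonneg (he n).1.le (sq_nonneg (X (n + 1 + 1) ω - M (n + 1) ω))
      linarith)
    (by
      filter_upwards [he0.eventually_le_const (show (0 : ℝ) < 1 / 2 by norm_num)] with n hn hSb
      have hstep := h.log_S_step hη hs₁ hA.le hR (by nlinarith) (n := n + 1) (by omega) hn ω
      have hE := hcos _ (hSpos n ω) hSb (X (n + 1) ω) (M (n + 1) ω)
      rw [← hcond n, ← hφ] at hE
      have hE' := mul_le_mul_of_nonneg_left hE hA.le
      have hAε : A * (1 / (4 * A)) = 1 / 4 := by field_simp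
      rw [mul_add, hAε] at hE'
      have hpot := three_le_three_mul_cos_add_min
        ((X (n + 1) ω - M (n + 1) ω) / Real.sqrt (S (n + 1) ω))
      rw [← hAφ] at hpot
      rw [Finset.sum_range_succ, add_sub_cancel_left]
      refine le_trans ?_ hstep
      set E := (P[cosInnovation X M S (n + 1) | h.filtration n]) ω
      set z := (X (n + 1) ω - M (n + 1) ω) / Real.sqrt (S (n + 1) ω)
      -- The margin is in fact 3 - 1 - 1/4 = 7/4; 1/4 is all that is required.
      have hkey : 1 / 4 ≤ potential A z - 1 - A * E := by
        rw [potential]; linarith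
      have := mul_le_mul_of_nonneg_left hkey (he n).1.le
      linarith)
  refine le_liminf_of_le (by isBoundedDefault) ?_
  have hev' := (eventually_atTop.mp hev)
  obtain ⟨n₀, hn₀⟩ := hev'
  filter_upwards [eventually_ge_atTop (n₀ + 1)] with n hn
  obtain ⟨k, rfl⟩ : ∃ k, n = k + 1 := ⟨n - 1, by omega⟩
  exact EReal.coe_le_coe_iff.mpr (hn₀ k (by omega))
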